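/- Write $F[h](t)=\int_{\mathbb R}h(x)e^{-itx}\,dx$ for $h\in L^1(\mathbb R)$, $F[\varphi](t)=\int_{\mathbb R} e^{-itx}\,d\varphi(x)$ for a probability measure $\varphi$ on $\mathbb R$, and $F^{-1}[u](x)=\frac1{2\pi}\int_{\mathbb R}u(t)e^{itx}\,dt$. Let $\phi,\psi:\mathbb R\to\mathbb C$ (in particular, real-valued functions are allowed) be the scaling function and an associated wavelet of a multiresolution analysis $(V_j)_{j\in\mathbb Z}$ of $L^2(\mathbb R)$, i.e. the integer translates of $\phi$ form an orthonormal basis of $V_0$ and those of $\psi$ form an orthonormal basis of $V_1\ominus V_0$. Then there are finite constants $A,v,U>0$, depending only on $\phi,\psi$, such that the following holds. Suppose that for some $0<a'<a$ the following condition is satisfied: $\phi,\psi\in L^p(\mathbb R)$ for every $1\le p\le\infty$, $\operatorname{supp}F[\phi]\subset[-a,a]$, $\operatorname{supp}F[\psi]\subset[-a,a]\setminus[-a',a']$, $\sup_{x\in\mathbb R}\sum_{k\in\mathbb Z}|\phi(x-k)|<\infty$ and $\sup_{x\in\mathbb R}\sum_{k\in\mathbb Z}|\psi(x-k)|<\infty$.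 Let $j\ge0$ be real and let $\varphi$ be a probability measure on $\mathbb R$ such that $|F[\varphi](t)|>0$ for all $t\in[-2^ja,2^ja]$. Then $$\delta_j:=\min_{t\in[-2^ja,2^ja]}|F[\varphi](t)|$$ exists and is positive; for every $k\in\mathbb Z$, with $\phi_{0k}(x)=\phi(x-k)$, the function $t\mapsto F[\phi_{0k}](2^{-j}t)\big/\big(2^j\,\overline{F[\varphi](t)}\big)$ (taken to be $0$ where its numerator vanishes) is integrable; and, putting $$\tilde\phi_{jk}:=F^{-1}\!\left[\frac{F[\phi_{0k}](2^{-j}\,\cdot)}{2^j\,\overline{F[\varphi]}}\right],\qquad \mathcal H_j:=\{\delta_j\tilde\phi_{jk}:k\in\mathbb Z\},$$ one has $\sup_{x\in\mathbb R}|h(x)|\le U$ for every $h\in\mathcal H_j$, $\mathcal H_j\subset L^2(Q)$ for every Borel probability measure $Q$ on $\mathbb R$, and $$\sup_Q N(\varepsilon,\mathcal H_j,L^2(Q))\le\left(\frac A\varepsilon\right)^v\qquad\text{for every }0<\varepsilon<A,$$ where the supremum extends over all Borel probability measures $Q$ on $\mathbb R$ and $N(\varepsilon,\mathcal H_j,L^2(Q))$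 is the least number of closed $L^2(Q)$-balls of radius $\varepsilon$ with centres in $\mathcal H_j$ that cover $\mathcal H_j$. -/

import Mathlib

open MeasureTheory Set
open scoped NNReal ENNReal ComplexConjugate

noncomputable section

namespace WaveletDeconv

/-- The complex Hilbert space `L²(ℝ)` (with respect to Lebesgue measure). -/
abbrev L2R : Type := Lp ℂ 2 (volume : Measure ℝ)

/-- The Fourier transform `F[h](t) = ∫ h(x) e^{-itx} dx` of an integrable function. -/
def fourierFun (h : ℝ → ℂ) (t : ℝ) : ℂ :=
  ∫ x : ℝ, h x * Complex.exp (-(Complex.I * t * x))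

/-- The Fourier transform `F[μ](t) = ∫ e^{-itx} dμ(x)` of a finite measure. -/
def fourierLaw (μ : Measure ℝ) (t : ℝ) : ℂ :=
  ∫ x : ℝ, Complex.exp (-(Complex.I * t * x)) ∂μ

/-- The inverse Fourier transform `F⁻¹[u](x) = (2π)⁻¹ ∫ u(t) e^{itx} dt`. -/
def fourierInv (u : ℝ → ℂ) (x : ℝ) : ℂ :=
  (1 / (2 * Real.pi) : ℂ) * ∫ t : ℝ, u t * Complex.exp (Complex.I * t * x)

/-- The integer translate `x ↦ f(x - k)`; for `f = φ` this is `φ_{0k}`. -/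
def translate (f : ℝ → ℂ) (k : ℤ) (x : ℝ) : ℂ := f (x - k)

/-- The integer translates of `f` belong to `L²(ℝ)` and form an orthonormal basis of the
closed subspace `W`. -/
def TranslatesONB (f : ℝ → ℂ) (W : Submodule ℂ L2R) : Prop :=
  ∃ e : ℤ → L2R, (∀ k, (e k : ℝ → ℂ) =ᵐ[volume] translate f k) ∧
    Orthonormal ℂ e ∧ (Submodule.span ℂ (range e)).topologicalClosure = W

/-- `(V_j)` is a multiresolution analysis of `L²(ℝ)` with scaling function `φ`. -/
structure IsMRA (V : ℤ → Submodule ℂ L2R) (φ : ℝ → ℂ) : Prop where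
  isClosed : ∀ j, IsClosed (V j : Set L2R)
  le_succ : ∀ j, V j ≤ V (j + 1)
  iInf_eq : ⨅ j, V j = ⊥
  dense : (⨆ j, V j).topologicalClosure = ⊤
  dilation : ∀ (j : ℤ) (f g : L2R), (∀ᵐ x : ℝ, g x = f (2 * x)) →
    (f ∈ V j ↔ g ∈ V (j + 1))
  basis : TranslatesONB φ (V 0)

/-- `φ` is the scaling function of a multiresolution analysis, and `ψ` an associated wavelet:
its integer translates form an orthonormal basis of the orthogonal complement of `V_0`
in `V_1`. -/
def IsScalingWaveletPair (φ ψ : ℝ → ℂ) : Prop :=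
  ∃ V : ℤ → Submodule ℂ L2R, IsMRA V φ ∧ TranslatesONB ψ (V 1 ⊓ (V 0)ᗮ)

/-- The band-limitation condition on the pair `φ, ψ`, with `0 < a' < a`. -/
structure BandLimited (φ ψ : ℝ → ℂ) (a' a : ℝ) : Prop where
  pos : 0 < a'
  lt : a' < a
  memLp_scaling : ∀ p : ℝ≥0∞, 1 ≤ p → MemLp φ p volume
  memLp_wavelet : ∀ p : ℝ≥0∞, 1 ≤ p → MemLp ψ p volume
  supp_scaling : tsupport (fourierFun φ) ⊆ Icc (-a) a
  supp_wavelet : tsupport (fourierFun ψ) ⊆ Icc (-a) a \ Icc (-a') a'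
  sum_scaling : ⨆ x : ℝ, ∑' k : ℤ, ‖φ (x - k)‖ₑ < ⊤
  sum_wavelet : ⨆ x : ℝ, ∑' k : ℤ, ‖ψ (x - k)‖ₑ < ⊤

/-- The interval `[-2^j a, 2^j a]`. -/
def band (a j : ℝ) : Set ℝ := Icc (-((2 : ℝ) ^ j * a)) ((2 : ℝ) ^ j * a)

/-- `δ_j`, the minimum of `|F[μ]|` over `[-2^j a, 2^j a]`. -/
def minModulus (μ : Measure ℝ) (a j : ℝ) : ℝ :=
  sInf ((fun t => ‖fourierLaw μ t‖) '' band a j)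

/-- The function `F[φ_{0k}](2^{-j} t) / (2^j conj F[μ](t))`. Where the numerator vanishes the
value is `0`, also at the zeros of `F[μ]`. -/
def deconvSymbol (φ : ℝ → ℂ) (μ : Measure ℝ) (j : ℝ) (k : ℤ) (t : ℝ) : ℂ :=
  fourierFun (translate φ k) ((2 : ℝ) ^ (-j) * t) /
    (((2 : ℝ) ^ j : ℝ) * conj (fourierLaw μ t))

/-- The deconvolved scaling function `φ̃_{jk}`. -/
def deconvScaling (φ : ℝ → ℂ) (μ : Measure ℝ) (j : ℝ) (k : ℤ) : ℝ → ℂ :=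
  fourierInv (deconvSymbol φ μ j k)

/-- The class `H_j = {δ_j φ̃_{jk} : k ∈ ℤ}`. -/
def deconvClass (φ : ℝ → ℂ) (μ : Measure ℝ) (a j : ℝ) : Set (ℝ → ℂ) :=
  range fun (k : ℤ) (x : ℝ) => (minModulus μ a j : ℂ) * deconvScaling φ μ j k x

/-- The elements of `L²(Q)` represented by the members of a class of functions. -/
def classInL2 (H : Set (ℝ → ℂ)) (Q : Measure ℝ) : Set (Lp ℂ 2 Q) :=
  {f | ∃ h ∈ H, (f : ℝ → ℂ) =ᵐ[Q] h}

/-- The covering number `N(ε, H, L²(Q))`: the least number of closed balls of radius `ε`, with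
centres in the class, that cover it. -/
def coveringL2 (ε : ℝ≥0) (H : Set (ℝ → ℂ)) (Q : Measure ℝ) : ℕ∞ :=
  Metric.coveringNumber ε (classInL2 H Q)

end WaveletDeconv

end

/-! Rescaling by `2 ^ j` turns the members of the class into integer shifts `F⁻¹[w](2 ^ j * x - k)`
of one function, where `w` is bounded by `∫ ‖φ‖` and vanishes off the band of `φ`. Both facts are
independent of `μ` and `j`, because `δ_j` bounds `|F[μ]|` from below on the band. Parseval on an
interval containing the band (`sum_sq_fourierInv_le`) gives `∑ k, ‖F⁻¹[w](y - k)‖ ^ 2 ≤ C` for all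
`y`. Integrating this against a probability measure `Q` bounds the sum of the squared `L²(Q)` norms
by `C`. Hence at most `4C / ε²` members have norm `≥ ε / 2`, and one more ball covers all the others
(`coveringNumber_range_le_of_sum_sq_le`), so the exponent is `v = 2`. -/

/-- A square-summable sequence in a normed space has a range with covering numbers of order
`ε⁻²`: all but finitely many of its members lie in the ball of radius `ε / 2`. -/
theorem coveringNumber_range_le_of_sum_sq_le {E : Type*} [NormedAddCommGroup E] (e : ℤ → E)
    {C : ℝ} (he : ∀ s : Finset ℤ, ∑ k ∈ s, ‖e k‖ ^ 2 ≤ C) {ε : ℝ≥0} (hε : 0 < ε)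
    (hεC : (ε : ℝ) ^ 2 ≤ 8 * C) :
    (Metric.coveringNumber ε (range e) : ℝ≥0∞) ≤ ENNReal.ofReal (8 * C / (ε : ℝ) ^ 2) := by
  have hε' : (0 : ℝ) < ε := hε
  have hsum : Summable fun k => ‖e k‖ ^ 2 := summable_of_sum_le (fun k => by positivity) he
  have hfin : {k | (ε / 2 : ℝ) ^ 2 ≤ ‖e k‖ ^ 2}.Finite := by
    have := Filter.eventually_cofinite.1 <| hsum.tendsto_cofinite_zero.eventually
      (gt_mem_nhds (by positivity : (0 : ℝ) < (ε / 2) ^ 2))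
    simpa only [not_lt] using this
  set S := hfin.toFinset with hS
  have hmemS : ∀ k, k ∈ S ↔ (ε / 2 : ℝ) ^ 2 ≤ ‖e k‖ ^ 2 := fun k => by simp [hS]
  have hcard : (S.card : ℝ) * (ε / 2) ^ 2 ≤ C := by
    rw [← nsmul_eq_mul]
    exact (Finset.card_nsmul_le_sum _ _ _ fun k hk => (hmemS k).1 hk).trans (he S)
  have hsmall : ∀ k ∉ S, ‖e k‖ ≤ ε / 2 := fun k hk => by
    rw [hmemS, not_le] at hk
    exact (lt_of_pow_lt_pow_left₀ 2 (by positivity) hk).le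
  have key : ∀ T : Finset ℤ, Metric.IsCover ε (range e) (e '' T) →
      (T.card : ℝ) ≤ 8 * C / (ε : ℝ) ^ 2 →
      (Metric.coveringNumber ε (range e) : ℝ≥0∞) ≤ ENNReal.ofReal (8 * C / (ε : ℝ) ^ 2) := by
    intro T hT hTc
    have h1 : Metric.coveringNumber ε (range e) ≤ (T.card : ℕ∞) :=
      (hT.coveringNumber_le_encard (image_subset_range _ _)).trans
        ((encard_image_le _ _).trans (by simp))
    calc (Metric.coveringNumber ε (range e) : ℝ≥0∞) ≤ ((T.card : ℕ∞) : ℝ≥0∞) := by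
          exact_mod_cast h1
      _ = ENNReal.ofReal (T.card : ℝ) := by simp
      _ ≤ _ := ENNReal.ofReal_le_ofReal hTc
  -- Centres must lie in the class, so a small member replaces the origin; two small members are
  -- within `ε / 2 + ε / 2` of each other.
  obtain ⟨k₀, hk₀⟩ := Infinite.exists_notMem_finset S
  refine key (insert k₀ S) ?_ ?_
  · rw [Metric.isCover_iff_subset_iUnion_closedBall]
    rintro _ ⟨k, rfl⟩
    simp only [mem_iUnion]
    by_cases hk : k ∈ S
    · exact ⟨e k, ⟨k, by simp [hk], rfl⟩, Metric.mem_closedBall_self hε'.le⟩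
    · refine ⟨e k₀, ⟨k₀, by simp, rfl⟩, ?_⟩
      rw [Metric.mem_closedBall, dist_eq_norm]
      linarith [norm_sub_le (e k) (e k₀), hsmall k hk, hsmall k₀ hk₀]
  · rw [Finset.card_insert_of_notMem hk₀, le_div_iff₀ (by positivity)]
    push_cast
    -- The count is `S.card + 1`. It is at most `2 * S.card ≤ 8C / ε²` if `S` is nonempty; otherwise
    -- it is `1`, which `hεC` covers.
    by_cases h0 : S.card = 0
    · rw [h0]; simpa using hεC
    · have : (1 : ℝ) ≤ S.card := by exact_mod_cast Nat.one_le_iff_ne_zero.2 h0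
      nlinarith [sq_nonneg (ε : ℝ)]

namespace WaveletDeconv

theorem norm_toLp_sq {Q : Measure ℝ} {f : ℝ → ℂ} (hf : MemLp f 2 Q) :
    ‖hf.toLp f‖ ^ 2 = ∫ x, ‖f x‖ ^ 2 ∂Q := by
  have h := hf.eLpNorm_eq_integral_rpow_norm (by norm_num) (by norm_num)
  have h0 : 0 ≤ ∫ x, ‖f x‖ ^ 2 ∂Q := integral_nonneg fun x => by positivity
  rw [Lp.norm_toLp, h]
  simp only [ENNReal.toReal_ofNat, Real.rpow_ofNat]
  rw [ENNReal.toReal_ofReal (by positivity), ← Real.rpow_natCast, ← Real.rpow_mul h0]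
  norm_num

/-- The bound on the squares is pointwise, so integrating it against any probability measure
preserves the constant; this gives uniformity in `Q`. -/
theorem coveringL2_range_le {Q : Measure ℝ} [IsProbabilityMeasure Q] {f : ℤ → ℝ → ℂ} {C : ℝ}
    (hf : ∀ k, MemLp (f k) 2 Q) (hC : ∀ x (s : Finset ℤ), ∑ k ∈ s, ‖f k x‖ ^ 2 ≤ C)
    {ε : ℝ≥0} (hε : 0 < ε) (hεC : (ε : ℝ) ^ 2 ≤ 8 * C) :
    (coveringL2 ε (range f) Q : ℝ≥0∞) ≤ ENNReal.ofReal (8 * C / (ε : ℝ) ^ 2) := by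
  have hclass : classInL2 (range f) Q = range fun k => (hf k).toLp (f k) := by
    ext g
    simp only [classInL2, mem_ofPred_eq, mem_range, exists_exists_eq_and]
    refine exists_congr fun k => ⟨fun h => ?_, ?_⟩
    · exact Lp.ext ((hf k).coeFn_toLp.trans h.symm)
    · rintro rfl
      exact (hf k).coeFn_toLp
  rw [coveringL2, hclass]
  refine coveringNumber_range_le_of_sum_sq_le _ (fun s => ?_) hε hεC
  have hint : ∀ k, Integrable (fun x => ‖f k x‖ ^ 2) Q := fun k =>
    (memLp_two_iff_integrable_sq_norm (hf k).1).1 (hf k)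
  simp_rw [norm_toLp_sq]
  rw [← integral_finsetSum _ fun k _ => hint k]
  calc _ ≤ ∫ _, C ∂Q :=
        integral_mono (integrable_finsetSum _ fun k _ => hint k) (integrable_const C)
          fun x => hC x s
    _ = C := by simp

/-! ### Fourier transforms and lattice sampling -/

theorem norm_exp_I_mul_mul (t x : ℝ) : ‖Complex.exp (Complex.I * t * x)‖ = 1 := by
  rw [mul_assoc, mul_comm, ← Complex.ofReal_mul]
  exact Complex.norm_exp_ofReal_mul_I _

theorem norm_exp_neg_I_mul_mul (t x : ℝ) : ‖Complex.exp (-(Complex.I * t * x))‖ = 1 := by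
  rw [Complex.exp_neg, norm_inv, norm_exp_I_mul_mul, inv_one]

theorem continuous_fourierInv {w : ℝ → ℂ} (hw : Integrable w) : Continuous (fourierInv w) := by
  refine continuous_const.mul (continuous_of_dominated (bound := fun t => ‖w t‖) (fun x => ?_)
    (fun x => ?_) hw.norm ?_)
  · exact hw.1.mul (by fun_prop : Continuous _).aestronglyMeasurable
  · exact ae_of_all _ fun t => by rw [norm_mul, norm_exp_I_mul_mul, mul_one]
  · exact ae_of_all _ fun t => by fun_prop

theorem continuous_fourierFun {h : ℝ → ℂ} (hh : Integrable h) : Continuous (fourierFun h) := by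
  refine continuous_of_dominated (bound := fun t => ‖h t‖) (fun x => ?_)
    (fun x => ?_) hh.norm ?_
  · exact hh.1.mul (by fun_prop : Continuous _).aestronglyMeasurable
  · exact ae_of_all _ fun t => by rw [norm_mul, norm_exp_neg_I_mul_mul, mul_one]
  · exact ae_of_all _ fun t => by fun_prop

theorem norm_fourierFun_le (h : ℝ → ℂ) (t : ℝ) : ‖fourierFun h t‖ ≤ ∫ x, ‖h x‖ := by
  refine (norm_integral_le_integral_norm _).trans_eq ?_
  simp_rw [norm_mul, norm_exp_neg_I_mul_mul, mul_one]

theorem continuous_fourierLaw (μ : Measure ℝ) [IsFiniteMeasure μ] : Continuous (fourierLaw μ) := by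
  refine continuous_of_dominated (bound := fun _ => 1) (fun x => ?_)
    (fun x => ?_) (integrable_const 1) ?_
  · exact (by fun_prop : Continuous _).aestronglyMeasurable
  · exact ae_of_all _ fun t => by rw [norm_exp_neg_I_mul_mul]
  · exact ae_of_all _ fun t => by fun_prop

theorem fourierFun_translate (f : ℝ → ℂ) (k : ℤ) (t : ℝ) :
    fourierFun (translate f k) t = Complex.exp (-(Complex.I * t * k)) * fourierFun f t := by
  unfold fourierFun translate
  rw [← integral_const_mul,
    ← integral_sub_right_eq_self (fun x : ℝ => _ * (f x * _)) (k : ℝ)]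
  refine integral_congr_ae (ae_of_all _ fun x => ?_)
  simp only
  rw [mul_left_comm, ← Complex.exp_add]
  congr 2
  push_cast
  ring

/-- The Plancherel–Pólya inequality on the integer lattice, for the inverse transform of a bounded
function with compact support. -/
theorem sum_sq_fourierInv_le {w : ℝ → ℂ} (hw : Measurable w) {B : ℝ} (hB : ∀ t, ‖w t‖ ≤ B)
    {M : ℕ} (hM : 0 < M) (hsupp : ∀ t, t ∉ Ioc (-(Real.pi * M)) (Real.pi * M) → w t = 0)
    (y : ℝ) (s : Finset ℤ) :
    ∑ k ∈ s, ‖fourierInv w (y - k)‖ ^ 2 ≤ (M * B) ^ 2 := by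
  have hM' : (0 : ℝ) < M := by exact_mod_cast hM
  have hpi := Real.pi_pos
  have hab : -(Real.pi * M) < Real.pi * M := by nlinarith [mul_pos hpi hM']
  set g : ℝ → ℂ := fun t => w t * Complex.exp (Complex.I * t * y) with hg
  have hgn : ∀ t, ‖g t‖ = ‖w t‖ := fun t => by rw [hg, norm_mul, norm_exp_I_mul_mul, mul_one]
  have hgm : AEStronglyMeasurable g (volume.restrict (Ioc (-(Real.pi * M)) (Real.pi * M))) :=
    (hw.mul (by fun_prop : Continuous _).measurable).aestronglyMeasurable
  have hg2 : MemLp g 2 (volume.restrict (Ioc (-(Real.pi * M)) (Real.pi * M))) :=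
    MemLp.of_bound hgm B (ae_of_all _ fun t => (hgn t).trans_le (hB t))
  -- On an interval of length `2πM` the characters are `e^{int/M}`, so the sample at `y - k` is the
  -- coefficient of index `k * M`. The factor `M` is the ratio of the normalisations `1 / (2π)` and
  -- `1 / (2πM)`; the shift `y` is absorbed into the phase of `g`.
  have hcoeff : ∀ k : ℤ,
      ‖fourierInv w (y - k)‖ ^ 2 = M ^ 2 * ‖fourierCoeffOn hab g (k * M)‖ ^ 2 := by
    intro k
    have : fourierInv w (y - k) = M * fourierCoeffOn hab g (k * M) := by
      rw [fourierCoeffOn_eq_integral, intervalIntegral.integral_of_le hab.le,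
        setIntegral_eq_integral_of_forall_compl_eq_zero
          fun t ht => by simp [hg, hsupp t ht], fourierInv]
      have hi : ∀ t : ℝ, (fourier (-(k * M)) (t : AddCircle (Real.pi * M - -(Real.pi * M)))) • g t
          = w t * Complex.exp (Complex.I * t * ((y - k : ℝ) : ℂ)) := by
        intro t
        rw [fourier_coe_apply, hg, smul_eq_mul, mul_left_comm, ← Complex.exp_add]
        congr 2
        have h1 : (M : ℂ) ≠ 0 := by exact_mod_cast hM.ne'
        have h2 : (Real.pi : ℂ) ≠ 0 := by exact_mod_cast hpi.ne'
        push_cast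
        have h3 : (Real.pi * M - -(Real.pi * M) : ℂ) = 2 * Real.pi * M := by ring
        rw [h3]
        field_simp
        ring
      simp_rw [hi]
      rw [Complex.real_smul, ← mul_assoc]
      congr 1
      have h1 : (M : ℂ) ≠ 0 := by exact_mod_cast hM.ne'
      have h2 : (Real.pi : ℂ) ≠ 0 := by exact_mod_cast hpi.ne'
      push_cast
      have h3 : (Real.pi * M - -(Real.pi * M) : ℂ) = 2 * Real.pi * M := by ring
      rw [h3]
      field_simp
    rw [this, norm_mul, mul_pow]
    simp
  have hparseval := hasSum_sq_fourierCoeffOn hab hg2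
  have hinj : Function.Injective fun k : ℤ => k * (M : ℤ) :=
    mul_left_injective₀ (by exact_mod_cast hM.ne')
  have hle : ∑ k ∈ s, ‖fourierCoeffOn hab g (k * M)‖ ^ 2 ≤ B ^ 2 := by
    calc ∑ k ∈ s, ‖fourierCoeffOn hab g (k * M)‖ ^ 2
        = ∑ n ∈ s.map ⟨_, hinj⟩, ‖fourierCoeffOn hab g n‖ ^ 2 := by simp
      _ ≤ _ := sum_le_hasSum _ (fun n _ => by positivity) hparseval
      _ ≤ (Real.pi * M - -(Real.pi * M))⁻¹ • ∫ _ in (-(Real.pi * M))..(Real.pi * M), B ^ 2 := by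
          refine smul_le_smul_of_nonneg_left ?_ (by rw [inv_nonneg]; linarith)
          refine intervalIntegral.integral_mono_on hab.le ?_ (by simp) fun t _ => ?_
          · rw [intervalIntegrable_iff_integrableOn_Ioc_of_le hab.le]
            exact (memLp_two_iff_integrable_sq_norm hgm).1 hg2
          · rw [hgn]
            exact pow_le_pow_left₀ (norm_nonneg _) (hB t) 2
      _ = B ^ 2 := by
          rw [intervalIntegral.integral_const, smul_smul, inv_mul_cancel₀ (by linarith), one_smul]
  simp_rw [hcoeff]
  rw [← Finset.mul_sum, mul_pow]
  exact mul_le_mul_of_nonneg_left hle (by positivity)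

/-! ### The normalised deconvolution symbol -/

theorem isLeast_minModulus (μ : Measure ℝ) [IsFiniteMeasure μ] {a : ℝ} (ha : 0 ≤ a) (j : ℝ) :
    IsLeast ((fun t => ‖fourierLaw μ t‖) '' band a j) (minModulus μ a j) := by
  refine IsCompact.isLeast_sInf (isCompact_Icc.image (continuous_fourierLaw μ).norm) ?_
  refine Nonempty.image _ (nonempty_Icc.2 ?_)
  have : 0 ≤ (2 : ℝ) ^ j * a := by positivity
  linarith

theorem mul_mem_band {a j s : ℝ} : (2 : ℝ) ^ j * s ∈ band a j ↔ s ∈ Icc (-a) a := by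
  have h2 : (0 : ℝ) < 2 ^ j := by positivity
  rw [band, mem_Icc, mem_Icc, ← mul_neg, mul_le_mul_iff_right₀ h2, mul_le_mul_iff_right₀ h2]

theorem rpow_neg_mul_mem_Icc {a j t : ℝ} : (2 : ℝ) ^ (-j) * t ∈ Icc (-a) a ↔ t ∈ band a j := by
  rw [← mul_mem_band (j := j), ← mul_assoc, ← Real.rpow_add two_pos]
  simp

/-- The symbol of the deconvolved scaling function, at unit scale and normalised by `δ_j`. -/
noncomputable def unitSymbol (φ : ℝ → ℂ) (μ : Measure ℝ) (a j s : ℝ) : ℂ :=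
  minModulus μ a j * (fourierFun φ s / conj (fourierLaw μ ((2 : ℝ) ^ j * s)))

theorem measurable_unitSymbol {φ : ℝ → ℂ} (hφ : Integrable φ) (μ : Measure ℝ)
    [IsFiniteMeasure μ] (a j : ℝ) : Measurable (unitSymbol φ μ a j) := by
  have h1 := (continuous_fourierFun hφ).measurable
  have h2 : Measurable fun s : ℝ => conj (fourierLaw μ ((2 : ℝ) ^ j * s)) :=
    (Complex.continuous_conj.comp
      ((continuous_fourierLaw μ).comp (continuous_const.mul continuous_id))).measurable
  exact (h1.div h2).const_mul _

theorem norm_unitSymbol_le {φ : ℝ → ℂ} {μ : Measure ℝ} [IsFiniteMeasure μ] {a : ℝ} (ha : 0 ≤ a)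
    (hsupp : ∀ s ∉ Icc (-a) a, fourierFun φ s = 0) {j : ℝ} (hδ : 0 < minModulus μ a j) (s : ℝ) :
    ‖unitSymbol φ μ a j s‖ ≤ ∫ x, ‖φ x‖ := by
  by_cases hs : s ∈ Icc (-a) a
  · have hle : minModulus μ a j ≤ ‖fourierLaw μ ((2 : ℝ) ^ j * s)‖ :=
      (isLeast_minModulus μ ha j).2 ⟨_, mul_mem_band.2 hs, rfl⟩
    have hpos := hδ.trans_le hle
    rw [unitSymbol, norm_mul, norm_div, RCLike.norm_conj, Complex.norm_real, Real.norm_of_nonneg hδ.le,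
      mul_div_left_comm]
    refine (mul_le_of_le_one_right (norm_nonneg _) ((div_le_one hpos).2 hle)).trans ?_
    exact norm_fourierFun_le φ s
  · rw [unitSymbol, hsupp s hs, zero_div, mul_zero, norm_zero]
    exact integral_nonneg fun x => norm_nonneg _

theorem integrable_deconvSymbol {φ : ℝ → ℂ} (hφ : Integrable φ) {μ : Measure ℝ}
    [IsFiniteMeasure μ] {a : ℝ} (hsupp : ∀ s ∉ Icc (-a) a, fourierFun φ s = 0) {j : ℝ}
    (hμ : ∀ t ∈ band a j, 0 < ‖fourierLaw μ t‖) (k : ℤ) : Integrable (deconvSymbol φ μ j k) := by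
  have hcont : ContinuousOn (deconvSymbol φ μ j k) (band a j) := by
    have h1 := continuous_fourierFun (h := translate φ k) (hφ.comp_sub_right (k : ℝ))
    have h2 := continuous_fourierLaw μ
    refine ContinuousOn.div (by fun_prop) (Continuous.continuousOn (by fun_prop)) fun t ht => ?_
    have h3 : ((2 : ℝ) ^ j : ℝ) ≠ 0 := by positivity
    simpa [h3] using norm_pos_iff.1 (hμ t ht)
  -- Off the band the numerator vanishes, so zeros of `F[μ]` there do no harm.
  refine (hcont.integrableOn_compact isCompact_Icc).integrable_of_forall_notMem_eq_zero
    fun t ht => ?_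
  rw [deconvSymbol, fourierFun_translate, hsupp _ (rpow_neg_mul_mem_Icc.not.2 ht)]
  simp

/-- The substitution `t = 2 ^ j * s` cancels the factor `2 ^ j` in the denominator, and the phase of
the translate becomes the shift by `k`. -/
theorem minModulus_mul_deconvScaling (φ : ℝ → ℂ) (μ : Measure ℝ) (a j : ℝ) (k : ℤ) (x : ℝ) :
    minModulus μ a j * deconvScaling φ μ j k x
      = fourierInv (unitSymbol φ μ a j) ((2 : ℝ) ^ j * x - k) := by
  have h2 : (0 : ℝ) < 2 ^ j := by positivity
  have h2' : (((2 : ℝ) ^ j : ℝ) : ℂ) ≠ 0 := by exact_mod_cast h2.ne'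
  have hinv : (2 : ℝ) ^ (-j) * 2 ^ j = 1 := by rw [← Real.rpow_add two_pos]; simp
  have hscale := Measure.integral_comp_mul_left
    (fun t : ℝ => deconvSymbol φ μ j k t * Complex.exp (Complex.I * t * x)) ((2 : ℝ) ^ j)
  rw [abs_of_pos (inv_pos.2 h2), Complex.real_smul, Complex.ofReal_inv,
    eq_inv_mul_iff_mul_eq₀ h2'] at hscale
  rw [deconvScaling, fourierInv, fourierInv, ← hscale, mul_left_comm, ← integral_const_mul,
    ← integral_const_mul]
  congr 1
  refine integral_congr_ae (ae_of_all _ fun s => ?_)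
  simp only [deconvSymbol, unitSymbol]
  rw [← mul_assoc ((2 : ℝ) ^ (-j)), hinv, one_mul, fourierFun_translate]
  have hexp : Complex.exp (Complex.I * s * (((2 : ℝ) ^ j * x - k : ℝ) : ℂ))
      = Complex.exp (-(Complex.I * s * k))
        * Complex.exp (Complex.I * ((2 : ℝ) ^ j * s : ℝ) * x) := by
    rw [← Complex.exp_add]
    congr 1
    push_cast
    ring
  rw [hexp]
  field_simp

end WaveletDeconv

open WaveletDeconv in
theorem lemma1 (φ ψ : ℝ → ℂ) (hpair : IsScalingWaveletPair φ ψ) :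
    ∃ A v U : ℝ, 0 < A ∧ 0 < v ∧ 0 < U ∧
      ∀ a' a : ℝ, BandLimited φ ψ a' a →
      ∀ (μ : MeasureTheory.Measure ℝ) [MeasureTheory.IsProbabilityMeasure μ] (j : ℝ), 0 ≤ j →
        (∀ t ∈ band a j, 0 < ‖fourierLaw μ t‖) →
        IsLeast ((fun t => ‖fourierLaw μ t‖) '' band a j) (minModulus μ a j) ∧
        0 < minModulus μ a j ∧
        (∀ k : ℤ, MeasureTheory.Integrable (deconvSymbol φ μ j k) MeasureTheory.volume) ∧
        (∀ h ∈ deconvClass φ μ a j, ∀ x : ℝ, ‖h x‖ ≤ U) ∧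
        ∀ (Q : MeasureTheory.Measure ℝ) [MeasureTheory.IsProbabilityMeasure Q],
          (∀ h ∈ deconvClass φ μ a j, MeasureTheory.MemLp h 2 Q) ∧
          ∀ ε : NNReal, 0 < ε → (ε : ℝ) < A →
            (coveringL2 ε (deconvClass φ μ a j) Q : ENNReal) ≤
              ENNReal.ofReal ((A / (ε : ℝ)) ^ v) := by
  -- The constants are chosen before `a'` and `a`: if no band is admissible the claim is vacuous,
  -- otherwise one admissible `a₀` fixes them.
  by_cases hex : ∃ a' a, BandLimited φ ψ a' a
  swap
  · exact ⟨1, 1, 1, one_pos, one_pos, one_pos, fun a' a h => absurd ⟨a', a, h⟩ hex⟩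
  obtain ⟨a₀', a₀, h₀⟩ := hex
  have hvanish : ∀ {a' a}, BandLimited φ ψ a' a → ∀ s ∉ Icc (-a) a, fourierFun φ s = 0 :=
    fun h s hs => image_eq_zero_of_notMem_tsupport fun hs' => hs (h.supp_scaling hs')
  have hφ : Integrable φ := memLp_one_iff_integrable.1 (h₀.memLp_scaling 1 le_rfl)
  set B : ℝ := ∫ x, ‖φ x‖
  obtain ⟨M, hM⟩ := exists_nat_gt a₀
  have ha₀ : 0 < a₀ := h₀.pos.trans h₀.lt
  have hM' : (0 : ℝ) < M := ha₀.trans hM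
  set C : ℝ := (M * B) ^ 2 + 1 with hC
  have hCpos : 0 < C := by positivity
  -- `(A / ε) ^ 2` equals `8C / ε²`, and `ε < A` gives `ε² ≤ 8C`. A single term of the sum of
  -- squares gives `U = √C`.
  refine ⟨√(8 * C), 2, √C, by positivity, two_pos, by positivity, ?_⟩
  intro a' a h μ _ j _ hμ
  have ha : 0 ≤ a := (h.pos.trans h.lt).le
  have hleast := isLeast_minModulus μ ha j
  have hδ : 0 < minModulus μ a j := by
    obtain ⟨t, ht, heq⟩ := hleast.1
    rw [← heq]
    exact hμ t ht
  set w := unitSymbol φ μ a j with hw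
  have hwm : Measurable w := measurable_unitSymbol hφ μ a j
  have hwB : ∀ s, ‖w s‖ ≤ B := norm_unitSymbol_le ha (hvanish h) hδ
  -- Whatever `a` is, `F[φ]` already vanishes off `[-a₀, a₀]`, so `M` need not depend on `a`.
  have hws : ∀ s, s ∉ Ioc (-(Real.pi * M)) (Real.pi * M) → w s = 0 := by
    intro s hs
    have : s ∉ Icc (-a₀) a₀ := fun hs' => hs (by
      constructor <;> nlinarith [hs'.1, hs'.2, Real.pi_gt_three])
    rw [hw, unitSymbol, hvanish h₀ s this, zero_div, mul_zero]
  have hwi : Integrable w := by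
    refine (Measure.integrableOn_of_bounded (s := Ioc (-(Real.pi * M)) (Real.pi * M)) (by simp)
      hwm.aestronglyMeasurable (ae_of_all _ hwB)).integrable_of_forall_notMem_eq_zero hws
  set f : ℤ → ℝ → ℂ := fun k x => fourierInv w ((2 : ℝ) ^ j * x - k) with hf
  have hclass : deconvClass φ μ a j = range f := by
    simp only [deconvClass, minModulus_mul_deconvScaling, hf, hw]
  have hsum : ∀ x (s : Finset ℤ), ∑ k ∈ s, ‖f k x‖ ^ 2 ≤ C := fun x s =>
    (sum_sq_fourierInv_le hwm hwB (by exact_mod_cast hM') hws _ s).trans (by simp [hC])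
  have hbound : ∀ k x, ‖f k x‖ ≤ √C := fun k x =>
    Real.le_sqrt_of_sq_le (by simpa using hsum x {k})
  have hfc : ∀ k, Continuous (f k) := fun k =>
    (continuous_fourierInv hwi).comp (by fun_prop)
  refine ⟨hleast, hδ, integrable_deconvSymbol hφ (hvanish h) hμ, ?_, fun Q _ => ?_⟩
  · rw [hclass]
    rintro _ ⟨k, rfl⟩ x
    exact hbound k x
  have hmem : ∀ k, MemLp (f k) 2 Q := fun k =>
    MemLp.of_bound (hfc k).aestronglyMeasurable _ (ae_of_all _ (hbound k))
  rw [hclass]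
  refine ⟨?_, fun ε hε hεA => ?_⟩
  · rintro _ ⟨k, rfl⟩
    exact hmem k
  · rw [Real.rpow_two, div_pow, Real.sq_sqrt (by positivity)]
    exact coveringL2_range_le hmem hsum hε ((Real.lt_sqrt ε.coe_nonneg).1 hεA).le
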